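/- Consider a mass $d>0$ of players, each controlling a copy of a semi-Markov decision process (SMDP) with finite state space $\mathcal S$ and finite action space $\mathcal A$. Taking action $a$ in state $i$ yields reward $c_{ia}\in\mathbb R$, takes a random time with mean $t_{ia}>0$, and then leads to state $j$ with probability $p^a_{ij}$. A stationary policy $p$ chooses action $a$ in state $i$ with probability $p(a|i)$; assume that the embedded Markov chain, with transition probabilities $\sum_a p(a|i)p^a_{ij}$, is irreducible for every stationary policy. Let $R$ be a finite set of resources, $\mathsf A=(\mathsf a_{q,ia})_{q\in R,\,(i,a)\in\mathcal S\times\mathcal A}$ a nonnegative matrix and $b\in\mathbb R_{\ge0}^{R}$; the rates $x_{ia}$ at which the players take the actions are constrained by $\mathsf A x\le b$. Given waiting delays $w=(w_{ia})$, where $w_{ia}\ge 0$ is the time spent waiting before action $a$ in state $i$, and a policy $p$, let $\nu$ be the stationary distribution of the embedded chain and let $$\pi_i=\frac{\nu_i}{\sum_{j,a}\nu_j\,p(a|j)\,(t_{ja}+w_{ja})}$$ be the stationary rate of visits to state $i$ per unit of time. A triple $(p,x^o,w)$ is an *SMDP equilibrium* if $p$ is a stationary policy and 1. there are $V:\mathcal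 S\to\mathbb R$ and $\gamma\in\mathbb R$ such that, for all $i\in\mathcal S$, $V(i)=\max_{a}\big[c_{ia}+\gamma(t_{ia}+w_{ia})+\sum_{j\in\mathcal S}p^a_{ij}V(j)\big]$, and the maximum is attained at every $a$ with $p(a|i)>0$; 2. $x^o_{ia}=d\,\pi_i\,p(a|i)$ for all $i,a$; 3. $\mathsf A x^o\le b$; 4. $w=\mathsf A^T\delta$ for some $\delta\ge0$ with $\delta_q=0$ whenever $(\mathsf A x^o)_q<b_q$. Call $x=(x_{ia})\ge0$ *balanced* if $\sum_a x_{ia}=\sum_{j,a}x_{ja}p^a_{ji}$ for all $i$. Then: (a) If there is a balanced $x\ge 0$ with $\mathsf A x\le b$ and $\sum_{i,a}c_{ia}x_{ia}>0$ (feasibility), an SMDP equilibrium exists. (b) If for every $w\ge0$ the maximum of $\sum_{i,a}c_{ia}x_{ia}$ over balanced $x\ge0$ with $\sum_{i,a}(t_{ia}+w_{ia})x_{ia}=d$ is attained and positive (participation), then the time-average reward attained by the policy is the same in every SMDP equilibrium: there is a number $\rho$ such that, in every equilibrium $(p,x^o,w)$, from every initial state, the ratio of the expected reward collected to the expected time elapsed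 over the first $n$ transitions (waiting included) tends to $\rho$ as $n\to\infty$, and the total reward rate of the players is $\sum_{i,a}c_{ia}x^o_{ia}=d\rho$. -/

import Mathlib

open scoped Matrix

/-- A nonatomic game between a mass `d` of players, each controlling a copy of one semi-Markov
decision process with state space `S` and action space `A`, coupled by linear constraints on the
action rates, one for each resource in `R`. -/
structure SMDPGame (S A R : Type*) [Fintype S] [Fintype A] where
  /-- mass of players -/
  d : ℝ
  /-- `P a i j` is the probability of a transition from `i` to `j` under action `a` -/
  P : A → Matrix S S ℝ
  /-- `t i a` is the mean holding time in state `i` under action `a` -/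
  t : S → A → ℝ
  /-- `c i a` is the reward for taking action `a` in state `i` -/
  c : S → A → ℝ
  /-- `use q i a` is the amount of resource `q` consumed by action `a` in state `i` -/
  use : R → S → A → ℝ
  /-- `b q` is the rate at which resource `q` is provided -/
  b : R → ℝ
  d_pos : 0 < d
  P_mem : ∀ a i, P a i ∈ stdSimplex ℝ S
  t_pos : ∀ i a, 0 < t i a
  use_nonneg : ∀ q i a, 0 ≤ use q i a
  b_nonneg : ∀ q, 0 ≤ b q
  /-- under every stationary policy the embedded Markov chain is irreducible -/
  irreducible : ∀ p : S → A → ℝ, (∀ i, p i ∈ stdSimplex ℝ A) →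
    (Matrix.of fun i j => ∑ a, p i a * P a i j).IsIrreducible

namespace SMDPGame

variable {S A R : Type*} [Fintype S] [Fintype A]

/-- A stationary policy: `p i a` is the probability of choosing action `a` in state `i`. -/
def IsPolicy (p : S → A → ℝ) : Prop := ∀ i, p i ∈ stdSimplex ℝ A

/-- The transition matrix of the embedded Markov chain under the policy `p`. -/
def chain (G : SMDPGame S A R) (p : S → A → ℝ) : Matrix S S ℝ :=
  Matrix.of fun i j => ∑ a, p i a * G.P a i j

/-- `ν` is a stationary distribution of the embedded Markov chain under the policy `p`. -/
def IsStationary (G : SMDPGame S A R) (p : S → A → ℝ) (ν : S → ℝ) : Prop :=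
  ν ∈ stdSimplex ℝ S ∧ ν ᵥ* G.chain p = ν

/-- Mean time (holding plus waiting) spent at a visit of state `i`. -/
def meanTime (G : SMDPGame S A R) (p w : S → A → ℝ) (i : S) : ℝ :=
  ∑ a, p i a * (G.t i a + w i a)

/-- Mean reward collected at a visit of state `i`. -/
def meanReward (G : SMDPGame S A R) (p : S → A → ℝ) (i : S) : ℝ :=
  ∑ a, p i a * G.c i a

/-- `π i` is the stationary rate (number per unit of time) at which a single copy of the process,
with waiting delays `w` and policy `p`, visits state `i`: the stationary distribution of the
embedded chain divided by the mean time between transitions. -/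
def IsVisitRate (G : SMDPGame S A R) (p w : S → A → ℝ) (π : S → ℝ) : Prop :=
  ∃ ν : S → ℝ, G.IsStationary p ν ∧ ∀ i, π i = ν i / ∑ j, ν j * G.meanTime p w j

/-- The policy `p` solves the average-reward dynamic programming equation for delays `w`. -/
def SolvesDP (G : SMDPGame S A R) (p w : S → A → ℝ) : Prop :=
  ∃ (V : S → ℝ) (γ : ℝ), ∀ i,
    IsGreatest (Set.range fun a =>
      G.c i a + γ * (G.t i a + w i a) + ∑ j, G.P a i j * V j) (V i) ∧
    ∀ a, 0 < p i a → G.c i a + γ * (G.t i a + w i a) + ∑ j, G.P a i j * V j = V i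

/-- Total consumption rate of resource `q` at action rates `x`. -/
def usage (G : SMDPGame S A R) (x : S → A → ℝ) (q : R) : ℝ := ∑ i, ∑ a, G.use q i a * x i a

/-- Total reward rate at action rates `x`. -/
def rewardRate (G : SMDPGame S A R) (x : S → A → ℝ) : ℝ := ∑ i, ∑ a, G.c i a * x i a

/-- `(p, x, w)` is an SMDP equilibrium. -/
structure IsEquilibrium [Fintype R] (G : SMDPGame S A R) (p x w : S → A → ℝ) : Prop where
  policy : IsPolicy p
  solvesDP : G.SolvesDP p w
  rates : ∃ π : S → ℝ, G.IsVisitRate p w π ∧ ∀ i a, x i a = G.d * π i * p i a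
  resource : ∀ q, G.usage x q ≤ G.b q
  delay : ∃ δ : R → ℝ, (∀ q, 0 ≤ δ q) ∧ (∀ i a, w i a = ∑ q, G.use q i a * δ q) ∧
    ∀ q, G.usage x q < G.b q → δ q = 0

/-- `g` is the long-run time-average reward of the policy `p` under the delays `w`: from every
initial state, the ratio of expected reward to expected elapsed time over the first `n`
transitions tends to `g`. -/
def IsTimeAverageReward [DecidableEq S] (G : SMDPGame S A R) (p w : S → A → ℝ) (g : ℝ) : Prop :=
  ∀ i, Filter.Tendsto (fun n : ℕ =>
    (∑ k ∈ Finset.range n, ((G.chain p ^ k) *ᵥ G.meanReward p) i) /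
      ∑ k ∈ Finset.range n, ((G.chain p ^ k) *ᵥ G.meanTime p w) i) Filter.atTop (nhds g)

/-- The balance constraints: in each state, rate out equals rate in. -/
def Balanced (G : SMDPGame S A R) (x : S → A → ℝ) : Prop :=
  ∀ i, ∑ a, x i a = ∑ j, ∑ a, x j a * G.P a j i

/-- Feasibility: some action rates respecting balance and resources have positive reward. -/
def Feasibility (G : SMDPGame S A R) : Prop :=
  ∃ x : S → A → ℝ, (∀ i a, 0 ≤ x i a) ∧ G.Balanced x ∧ (∀ q, G.usage x q ≤ G.b q) ∧
    0 < G.rewardRate x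

/-- Participation: under all nonnegative delays `w`, the players' optimal reward is positive. -/
def Participation (G : SMDPGame S A R) : Prop :=
  ∀ w : S → A → ℝ, (∀ i a, 0 ≤ w i a) →
    ∃ M : ℝ, 0 < M ∧ IsGreatest (G.rewardRate '' {x | (∀ i a, 0 ≤ x i a) ∧ G.Balanced x ∧
      ∑ i, ∑ a, (G.t i a + w i a) * x i a = G.d}) M

end SMDPGame

/-!
# Equilibria of SMDP games with resource constraints

An equilibrium is exhibited as a maximiser of an Eisenberg-Gale type program: over the polyhedron
of nonnegative balanced rates `x` respecting the resources, maximise `d log (c ⬝ x) - t ⬝ x`. In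
order to stay with a function continuous on the whole polyhedron, the proof maximises its
exponential, `(c ⬝ x) exp (-(t ⬝ x) / d)`, instead. It tends to zero at infinity because `t` is
positive, so under feasibility the maximum is attained (`exists_maximizer`) and positive. Write `C`
for `c ⬝ x` at the maximiser. The first-order condition says that `c - (C / d) t` is nonpositive on
every direction that stays in the polyhedron (`first_order_condition`), and the Farkas lemma
(`exists_nonneg_sum_smul_eq`) writes it as a combination of the active constraints. The multipliers
of the balance constraints are the values `V`, those of the resources are, up to the factor `d / C`,
the prices `δ`, and the result is the dynamic programming equation with `γ = -C / d`
(`exists_multipliers`). Irreducibility makes every state visited at the maximiser, so that the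
policy can be read off by normalising `x`.

For uniqueness, the dynamic programming equation telescopes along the chain: the reward collected
over `n` transitions is `-γ` times the elapsed time, up to a bounded term, so the average reward is
`-γ` (`tendsto_average`). If `(x, w)` and `(x', w')` are equilibria with average rewards `g` and
`g'`, then the dynamic programming inequality for the first, tested on the rates of the second,
gives `g' d ≤ g (t + w) ⬝ x' ≤ g (d + t ⬝ x' - t ⬝ x)`, where complementary slackness bounds the
waiting cost `w ⬝ x'` by `w ⬝ x`. Participation makes `g` and `g'` positive, and adding this to
the symmetric inequality yields `g' / g + g / g' ≤ 2`, that is, `g = g'`.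
-/

open Filter Topology

/-! ### The Farkas lemma -/

/-- **Farkas lemma** for finitely many linear functionals on a real vector space: a functional
nonpositive wherever all `g k`, `k ∈ s`, are nonpositive is a nonnegative combination of them. -/
theorem exists_nonneg_sum_smul_eq {ι E : Type*} [AddCommGroup E] [Module ℝ E] (s : Finset ι)
    (g : ι → E →ₗ[ℝ] ℝ) (f : E →ₗ[ℝ] ℝ)
    (h : ∀ x, (∀ k ∈ s, g k x ≤ 0) → f x ≤ 0) :
    ∃ l : ι → ℝ, (∀ k, 0 ≤ l k) ∧ (∀ k ∉ s, l k = 0) ∧ f = ∑ k ∈ s, l k • g k := by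
  classical
  induction s using Finset.induction_on generalizing g f with
  | empty =>
    refine ⟨fun _ => 0, fun _ => le_rfl, fun _ _ => rfl, LinearMap.ext fun x => ?_⟩
    have h1 := h x (by simp)
    have h2 := h (-x) (by simp)
    rw [map_neg] at h2
    simp only [Finset.sum_empty, LinearMap.zero_apply]
    linarith
  | insert m s hm ih =>
    by_cases hs : ∀ x, (∀ k ∈ s, g k x ≤ 0) → f x ≤ 0
    · obtain ⟨l, hl0, hls, hlf⟩ := ih g f hs
      refine ⟨l, hl0, fun k hk => hls k fun hk' => hk (Finset.mem_insert_of_mem hk'), ?_⟩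
      rw [Finset.sum_insert hm, hls m hm, zero_smul, zero_add, hlf]
    · push Not at hs
      obtain ⟨z, hz, hfz⟩ := hs
      have hmz : 0 < g m z := by
        by_contra hc
        exact absurd (h z fun k hk => (Finset.mem_insert.1 hk).elim
          (fun e => e ▸ not_lt.1 hc) (hz k)) (not_le.2 hfz)
      -- Project along `z` onto the kernel of `g m`, where the induction hypothesis applies.
      obtain ⟨l, hl0, hls, hlf⟩ := ih (fun k => g k - (g k z / g m z) • g m)
        (f - (f z / g m z) • g m) (by
          intro x hx
          have key : ∀ φ : E →ₗ[ℝ] ℝ, φ (x - (g m x / g m z) • z) =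
              (φ - (φ z / g m z) • g m) x := by
            intro φ
            simp only [map_sub, map_smul, smul_eq_mul, LinearMap.sub_apply, LinearMap.smul_apply]
            ring
          rw [← key f]
          refine h _ fun k hk => ?_
          rcases Finset.mem_insert.1 hk with rfl | hk
          · rw [key, div_self hmz.ne', one_smul, sub_self, LinearMap.zero_apply]
          · rw [key]
            exact hx k hk)
      have hsum : ∑ k ∈ s, l k * g k z ≤ 0 :=
        Finset.sum_nonpos fun k hk => mul_nonpos_of_nonneg_of_nonpos (hl0 k) (hz k hk)
      refine ⟨Function.update l m ((f z - ∑ k ∈ s, l k * g k z) / g m z), fun k => ?_,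
        fun k hk => ?_, ?_⟩
      · rcases eq_or_ne k m with rfl | hkm
        · rw [Function.update_self]
          exact div_nonneg (by linarith) hmz.le
        · rw [Function.update_of_ne hkm]
          exact hl0 k
      · rw [Finset.mem_insert, not_or] at hk
        rw [Function.update_of_ne hk.1]
        exact hls k hk.2
      · have hupd : ∀ c, ∑ k ∈ s, Function.update l m c k • g k = ∑ k ∈ s, l k • g k := fun c =>
          Finset.sum_congr rfl fun k hk => by
            rw [Function.update_of_ne (ne_of_mem_of_not_mem hk hm)]
        rw [Finset.sum_insert hm, Function.update_self, hupd]
        ext x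
        have hx := LinearMap.congr_fun hlf x
        simp only [LinearMap.sub_apply, LinearMap.smul_apply, smul_eq_mul, LinearMap.sum_apply,
          mul_sub, Finset.sum_sub_distrib, LinearMap.add_apply] at hx ⊢
        have h3 : ∑ k ∈ s, l k * (g k z / g m z * g m x) =
            (∑ k ∈ s, l k * g k z) / g m z * g m x := by
          rw [Finset.sum_div, Finset.sum_mul]
          exact Finset.sum_congr rfl fun k _ => by ring
        rw [h3] at hx
        rw [sub_div, sub_mul]
        linarith

namespace SMDPGame

variable {S A R : Type*} [Fintype S] [Fintype A]

/-! ### Action rates and the dynamic programming inequality -/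

/-- The pairing `∑ i, ∑ a, u i a * x i a` of weights with action rates, linear in the rates. -/
def pair (u : S → A → ℝ) : (S → A → ℝ) →ₗ[ℝ] ℝ where
  toFun x := ∑ i, ∑ a, u i a * x i a
  map_add' x y := by simp only [Pi.add_apply, mul_add, Finset.sum_add_distrib]
  map_smul' r x := by
    simp only [Pi.smul_apply, smul_eq_mul, RingHom.id_apply, Finset.mul_sum]
    exact Finset.sum_congr rfl fun i _ => Finset.sum_congr rfl fun a _ => by ring

theorem pair_apply (u x : S → A → ℝ) : pair u x = ∑ i, ∑ a, u i a * x i a := rfl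

theorem pair_add_left (u v x : S → A → ℝ) : pair (u + v) x = pair u x + pair v x := by
  simp only [pair_apply, Pi.add_apply, add_mul, Finset.sum_add_distrib]

theorem pair_smul_left (r : ℝ) (u x : S → A → ℝ) : pair (r • u) x = r * pair u x := by
  simp only [pair_apply, Pi.smul_apply, smul_eq_mul, Finset.mul_sum, mul_assoc]

theorem pair_le_pair {u v x : S → A → ℝ} (hx : ∀ i a, 0 ≤ x i a)
    (h : ∀ i a, 0 < x i a → u i a ≤ v i a) : pair u x ≤ pair v x := by
  refine Finset.sum_le_sum fun i _ => Finset.sum_le_sum fun a _ => ?_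
  rcases (hx i a).eq_or_lt with h0 | h0
  · simp [← h0]
  · exact mul_le_mul_of_nonneg_right (h i a h0) h0.le

theorem continuous_pair (u : S → A → ℝ) : Continuous (pair u) := by
  change Continuous fun x : S → A → ℝ => ∑ i, ∑ a, u i a * x i a
  fun_prop

/-- The weight of the action rates in the excess of the inflow of the potential `V` over its
outflow. -/
def drift (G : SMDPGame S A R) (V : S → ℝ) : S → A → ℝ := fun i a => ∑ j, G.P a i j * V j - V i

theorem pair_drift (G : SMDPGame S A R) (V : S → ℝ) (x : S → A → ℝ) :
    pair (G.drift V) x = ∑ i, V i * (∑ j, ∑ a, x j a * G.P a j i - ∑ a, x i a) := by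
  simp only [pair_apply, drift, sub_mul, mul_sub, Finset.sum_sub_distrib, Finset.mul_sum]
  congr 1
  have h : ∀ i, ∑ a, (∑ j, G.P a i j * V j) * x i a = ∑ j, ∑ a, V j * (x i a * G.P a i j) := by
    intro i
    simp only [Finset.sum_mul]
    rw [Finset.sum_comm]
    exact Finset.sum_congr rfl fun j _ => Finset.sum_congr rfl fun a _ => by ring
  rw [Finset.sum_congr rfl fun i _ => h i, Finset.sum_comm]

theorem Balanced.pair_drift_eq_zero {G : SMDPGame S A R} {x : S → A → ℝ} (hx : G.Balanced x)
    (V : S → ℝ) : pair (G.drift V) x = 0 := by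
  rw [pair_drift]
  exact Finset.sum_eq_zero fun i _ => by rw [← hx i, sub_self, mul_zero]

/-- The dynamic programming inequality bounds the reward rate of all balanced rates. -/
theorem rewardRate_le {G : SMDPGame S A R} {x w : S → A → ℝ} {V : S → ℝ} {γ : ℝ}
    (hV : ∀ i a, G.c i a + γ * (G.t i a + w i a) + ∑ j, G.P a i j * V j ≤ V i)
    (hx : ∀ i a, 0 ≤ x i a) (hb : G.Balanced x) :
    G.rewardRate x ≤ -γ * pair (G.t + w) x := by
  have h : pair (G.c + γ • (G.t + w) + G.drift V) x ≤ pair 0 x :=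
    pair_le_pair hx fun i a _ => by
      have := hV i a
      simp only [Pi.add_apply, Pi.smul_apply, smul_eq_mul, Pi.zero_apply, drift]
      linarith
  rw [pair_add_left, pair_add_left, pair_smul_left, hb.pair_drift_eq_zero] at h
  simp only [pair_apply _ x, Pi.zero_apply, zero_mul, Finset.sum_const_zero] at h ⊢
  simp only [rewardRate]
  linarith

/-- Equality holds in the bound on the reward rate if only optimal actions are taken. -/
theorem rewardRate_eq {G : SMDPGame S A R} {x w : S → A → ℝ} {V : S → ℝ} {γ : ℝ}
    (hV : ∀ i a, 0 < x i a → G.c i a + γ * (G.t i a + w i a) + ∑ j, G.P a i j * V j = V i)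
    (hx : ∀ i a, 0 ≤ x i a) (hb : G.Balanced x) :
    G.rewardRate x = -γ * pair (G.t + w) x := by
  have h : pair (G.c + γ • (G.t + w) + G.drift V) x = pair 0 x := by
    refine le_antisymm (pair_le_pair hx fun i a h => ?_) (pair_le_pair hx fun i a h => ?_) <;>
    · have := hV i a h
      simp only [Pi.add_apply, Pi.smul_apply, smul_eq_mul, Pi.zero_apply, drift]
      linarith
  rw [pair_add_left, pair_add_left, pair_smul_left, hb.pair_drift_eq_zero] at h
  simp only [pair_apply _ x, Pi.zero_apply, zero_mul, Finset.sum_const_zero] at h ⊢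
  simp only [rewardRate]
  linarith

/-- The waiting time caused by prices `δ` is the value of the resources used. -/
theorem pair_delay [Fintype R] (G : SMDPGame S A R) {w : S → A → ℝ} {δ : R → ℝ}
    (hw : ∀ i a, w i a = ∑ q, G.use q i a * δ q) (x : S → A → ℝ) :
    pair w x = ∑ q, δ q * G.usage x q := by
  simp only [pair_apply, hw, usage, Finset.mul_sum, Finset.sum_mul]
  rw [Finset.sum_congr rfl fun i _ => Finset.sum_comm, Finset.sum_comm]
  exact Finset.sum_congr rfl fun q _ => Finset.sum_congr rfl fun i _ =>
    Finset.sum_congr rfl fun a _ => by ring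

/-! ### The chain of a policy -/

theorem chain_mem_rowStochastic [DecidableEq S] (G : SMDPGame S A R) {p : S → A → ℝ}
    (hp : IsPolicy p) : G.chain p ∈ Matrix.rowStochastic ℝ S := by
  rw [Matrix.mem_rowStochastic_iff_sum]
  refine ⟨fun i j => Finset.sum_nonneg fun a _ => mul_nonneg ((hp i).1 a) ((G.P_mem a i).1 j),
    fun i => ?_⟩
  simp only [chain, Matrix.of_apply]
  rw [Finset.sum_comm, ← (hp i).2]
  exact Finset.sum_congr rfl fun a _ => by rw [← Finset.mul_sum, (G.P_mem a i).2, mul_one]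

theorem IsPolicy.meanTime_pos {G : SMDPGame S A R} {p w : S → A → ℝ} (hp : IsPolicy p)
    (hw : ∀ i a, 0 ≤ w i a) (i : S) : 0 < G.meanTime p w i := by
  have hpos : ∀ a, 0 < G.t i a + w i a := fun a => add_pos_of_pos_of_nonneg (G.t_pos i a) (hw i a)
  obtain ⟨a, -, ha⟩ := Finset.exists_ne_zero_of_sum_ne_zero
    (show ∑ a, p i a ≠ 0 by rw [(hp i).2]; exact one_ne_zero)
  exact Finset.sum_pos' (fun a _ => mul_nonneg ((hp i).1 a) (hpos a).le)
    ⟨a, Finset.mem_univ a, mul_pos (((hp i).1 a).lt_of_ne' ha) (hpos a)⟩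

/-- An invariant nonnegative nonzero vector of the chain is positive, by irreducibility. -/
theorem pos_of_vecMul_chain_eq [DecidableEq S] (G : SMDPGame S A R) {p : S → A → ℝ}
    (hp : IsPolicy p) {y : S → ℝ} (hy : y ᵥ* G.chain p = y) (hy0 : ∀ i, 0 ≤ y i) {j : S}
    (hj : 0 < y j) (i : S) : 0 < y i := by
  have hirr : (G.chain p).IsIrreducible := G.irreducible p hp
  obtain ⟨k, -, hk⟩ :=
    (Matrix.isIrreducible_iff_exists_pow_pos hirr.nonneg).1 hirr j i
  have hpow : ∀ n : ℕ, y ᵥ* G.chain p ^ n = y := by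
    intro n
    induction n with
    | zero => rw [pow_zero, Matrix.vecMul_one]
    | succ n ih => rw [pow_succ, ← Matrix.vecMul_vecMul, ih, hy]
  rw [← hpow k]
  exact Finset.sum_pos' (fun l _ => mul_nonneg (hy0 l) (Matrix.pow_apply_nonneg hirr.nonneg k l i))
    ⟨j, Finset.mem_univ j, mul_pos hj hk⟩

theorem vecMul_chain_apply (G : SMDPGame S A R) (p : S → A → ℝ) (y : S → ℝ) (i : S) :
    (y ᵥ* G.chain p) i = ∑ j, ∑ a, y j * p j a * G.P a j i := by
  simp only [Matrix.vecMul, dotProduct, chain, Matrix.of_apply, Finset.mul_sum, mul_assoc]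

theorem pair_mul_policy (G : SMDPGame S A R) (p w : S → A → ℝ) (y : S → ℝ) :
    pair (G.t + w) (fun i a => y i * p i a) = ∑ i, y i * G.meanTime p w i := by
  simp only [pair_apply, meanTime, Finset.mul_sum, Pi.add_apply]
  exact Finset.sum_congr rfl fun i _ => Finset.sum_congr rfl fun a _ => by ring

/-! ### The time-average reward -/

/-- If the actions taken by `p` are optimal, the rewards and holding times telescope along the
chain, and the time-average reward is `-γ`. -/
theorem tendsto_average [DecidableEq S] {G : SMDPGame S A R} {p w : S → A → ℝ}
    (hp : IsPolicy p) (hw : ∀ i a, 0 ≤ w i a) {V : S → ℝ} {γ : ℝ}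
    (hV : ∀ i a, 0 < p i a → G.c i a + γ * (G.t i a + w i a) + ∑ j, G.P a i j * V j = V i) :
    G.IsTimeAverageReward p w (-γ) := by
  intro i
  set Q := G.chain p
  set τ := G.meanTime p w
  have hQ : ∀ k : ℕ, Q ^ k ∈ Matrix.rowStochastic ℝ S :=
    fun k => pow_mem (G.chain_mem_rowStochastic hp) k
  have hQ0 : ∀ k a b, 0 ≤ (Q ^ k) a b := fun k => ((Matrix.mem_rowStochastic_iff_sum).1 (hQ k)).1
  have hQ1 : ∀ k a, ∑ b, (Q ^ k) a b = 1 := fun k => ((Matrix.mem_rowStochastic_iff_sum).1 (hQ k)).2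
  have hpois : G.meanReward p = (-γ) • τ + (V - Q *ᵥ V) := by
    ext j
    have h1 : ∑ a, p j a * (G.c j a + γ * (G.t j a + w j a) + ∑ l, G.P a j l * V l) = V j := by
      rw [← one_mul (V j), ← (hp j).2, Finset.sum_mul]
      refine Finset.sum_congr rfl fun a _ => ?_
      rcases ((hp j).1 a).eq_or_lt with h0 | h0
      · rw [← h0, zero_mul, zero_mul]
      · rw [hV j a h0]
    have h2 : (Q *ᵥ V) j = ∑ a, p j a * ∑ l, G.P a j l * V l := by
      simp only [Q, Matrix.mulVec, dotProduct, chain, Matrix.of_apply, Finset.sum_mul,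
        Finset.mul_sum]
      rw [Finset.sum_comm]
      exact Finset.sum_congr rfl fun _ _ => Finset.sum_congr rfl fun _ _ => by ring
    have h3 : γ * τ j = ∑ a, p j a * (γ * (G.t j a + w j a)) := by
      simp only [τ, meanTime, Finset.mul_sum]
      exact Finset.sum_congr rfl fun _ _ => by ring
    simp only [Pi.add_apply, Pi.smul_apply, Pi.sub_apply, smul_eq_mul, meanReward, h2]
    simp only [mul_add, Finset.sum_add_distrib] at h1 h3 ⊢
    linarith
  have htel : ∀ n : ℕ, ∑ k ∈ Finset.range n, ((Q ^ k) *ᵥ G.meanReward p) i =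
      -γ * ∑ k ∈ Finset.range n, ((Q ^ k) *ᵥ τ) i + (V i - ((Q ^ n) *ᵥ V) i) := by
    intro n
    induction n with
    | zero => simp
    | succ n ih =>
      rw [Finset.sum_range_succ, ih, Finset.sum_range_succ, hpois, Matrix.mulVec_add,
        Matrix.mulVec_smul, Matrix.mulVec_sub, Matrix.mulVec_mulVec, ← pow_succ]
      simp only [Pi.add_apply, Pi.smul_apply, Pi.sub_apply, smul_eq_mul]
      ring
  obtain ⟨m, hm0, hm⟩ : ∃ m, 0 < m ∧ ∀ j, m ≤ τ j := by
    obtain ⟨j, -, hj⟩ := Finset.exists_min_image Finset.univ τ ⟨i, Finset.mem_univ i⟩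
    exact ⟨τ j, hp.meanTime_pos hw j, fun l => hj l (Finset.mem_univ l)⟩
  have hT : ∀ n : ℕ, n * m ≤ ∑ k ∈ Finset.range n, ((Q ^ k) *ᵥ τ) i := by
    intro n
    have : ∀ k ∈ Finset.range n, m ≤ ((Q ^ k) *ᵥ τ) i := fun k _ => by
      calc m = ∑ j, (Q ^ k) i j * m := by rw [← Finset.sum_mul, hQ1, one_mul]
        _ ≤ _ := Finset.sum_le_sum fun j _ => mul_le_mul_of_nonneg_left (hm j) (hQ0 k i j)
    simpa using Finset.card_nsmul_le_sum _ _ _ this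
  set B := ∑ j, |V j|
  have hle : ∀ j, |V j| ≤ B := fun j =>
    Finset.single_le_sum (fun l _ => abs_nonneg (V l)) (Finset.mem_univ j)
  have hB : ∀ n : ℕ, |V i - ((Q ^ n) *ᵥ V) i| ≤ 2 * B := by
    intro n
    have : |((Q ^ n) *ᵥ V) i| ≤ B := by
      calc |((Q ^ n) *ᵥ V) i| ≤ ∑ j, |(Q ^ n) i j * V j| := Finset.abs_sum_le_sum_abs _ _
        _ ≤ ∑ j, (Q ^ n) i j * B := Finset.sum_le_sum fun j _ => by
          rw [abs_mul, abs_of_nonneg (hQ0 n i j)]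
          exact mul_le_mul_of_nonneg_left (hle j) (hQ0 n i j)
        _ = B := by rw [← Finset.sum_mul, hQ1, one_mul]
    exact (abs_sub _ _).trans (by linarith [hle i])
  have hlim : Tendsto (fun n : ℕ => 2 * B / (n * m)) atTop (𝓝 0) :=
    (tendsto_natCast_atTop_atTop.atTop_mul_const hm0).const_div_atTop _
  have herr : Tendsto (fun n : ℕ => (V i - ((Q ^ n) *ᵥ V) i) /
      ∑ k ∈ Finset.range n, ((Q ^ k) *ᵥ τ) i) atTop (𝓝 0) := by
    refine squeeze_zero_norm' ?_ hlim
    filter_upwards [eventually_gt_atTop 0] with n hn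
    have hnm : 0 < n * m := mul_pos (Nat.cast_pos.2 hn) hm0
    rw [Real.norm_eq_abs, abs_div, abs_of_pos (hnm.trans_le (hT n))]
    exact div_le_div₀ ((abs_nonneg _).trans (hB n)) (hB n) hnm (hT n)
  have := herr.const_add (-γ)
  rw [add_zero] at this
  refine this.congr' ?_
  filter_upwards [eventually_gt_atTop 0] with n hn
  have hpos := (mul_pos (Nat.cast_pos.2 hn) hm0).trans_le (hT n)
  rw [htel n, add_div, mul_div_cancel_right₀ _ hpos.ne']

/-! ### Uniqueness of the average reward -/

theorem IsEquilibrium.delay_nonneg [Fintype R] {G : SMDPGame S A R} {p x w : S → A → ℝ}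
    (h : G.IsEquilibrium p x w) (i : S) (a : A) : 0 ≤ w i a := by
  obtain ⟨δ, hδ, hw, -⟩ := h.delay
  rw [hw]
  exact Finset.sum_nonneg fun q _ => mul_nonneg (G.use_nonneg q i a) (hδ q)

/-- Equilibrium rates are nonnegative, supported by the policy, balanced, and take up the time of
all players. -/
theorem IsEquilibrium.rates_spec [Fintype R] {G : SMDPGame S A R} {p x w : S → A → ℝ}
    (h : G.IsEquilibrium p x w) :
    (∀ i a, 0 ≤ x i a) ∧ (∀ i a, 0 < x i a → 0 < p i a) ∧ G.Balanced x ∧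
      pair (G.t + w) x = G.d := by
  obtain ⟨π, ⟨ν, ⟨hν, hinv⟩, hπ⟩, hx⟩ := h.rates
  have hp := h.policy
  have hpos := hp.meanTime_pos (G := G) h.delay_nonneg
  have hD : 0 < ∑ j, ν j * G.meanTime p w j := by
    obtain ⟨j, -, hj⟩ := Finset.exists_ne_zero_of_sum_ne_zero
      (show ∑ j, ν j ≠ 0 by rw [hν.2]; exact one_ne_zero)
    exact Finset.sum_pos' (fun j _ => mul_nonneg (hν.1 j) (hpos j).le)
      ⟨j, Finset.mem_univ j, mul_pos ((hν.1 j).lt_of_ne' hj) (hpos j)⟩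
  set D := ∑ j, ν j * G.meanTime p w j
  have hx' : x = fun i a => ((G.d / D) • ν) i * p i a := by
    funext i a
    rw [hx, hπ, Pi.smul_apply, smul_eq_mul]
    ring
  have hx0 : ∀ i a, 0 ≤ x i a := fun i a => by
    rw [hx']
    exact mul_nonneg (mul_nonneg (div_nonneg G.d_pos.le hD.le) (hν.1 i)) ((hp i).1 a)
  refine ⟨hx0, fun i a hia => ((hp i).1 a).lt_of_ne' fun h0 => ?_, fun i => ?_, ?_⟩
  · rw [hx i a, h0, mul_zero] at hia
    exact lt_irrefl _ hia
  · simp only [hx']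
    rw [← Finset.mul_sum, (hp i).2, mul_one, ← vecMul_chain_apply, Matrix.smul_vecMul, hinv]
  · rw [hx', pair_mul_policy]
    simp only [Pi.smul_apply, smul_eq_mul, mul_assoc]
    rw [← Finset.mul_sum]
    exact div_mul_cancel₀ _ hD.ne'

/-- By complementary slackness, no admissible rates suffer a larger total waiting time than the
equilibrium rates. -/
theorem IsEquilibrium.pair_delay_le [Fintype R] {G : SMDPGame S A R} {p x w y : S → A → ℝ}
    (h : G.IsEquilibrium p x w) (hy : ∀ q, G.usage y q ≤ G.b q) : pair w y ≤ pair w x := by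
  obtain ⟨δ, hδ, hw, hslack⟩ := h.delay
  rw [G.pair_delay hw, G.pair_delay hw]
  refine Finset.sum_le_sum fun q _ => ?_
  rcases (h.resource q).lt_or_eq with hq | hq
  · rw [hslack q hq, zero_mul, zero_mul]
  · rw [hq]
    exact mul_le_mul_of_nonneg_left (hy q) (hδ q)

/-- Under participation, every equilibrium has a positive average reward `g`, both as a time average
of the process and as a rate per player, and the dynamic programming inequality bounds the reward of
all balanced rates by `g` times the time they take. -/
theorem IsEquilibrium.exists_average [Fintype R] [DecidableEq S] {G : SMDPGame S A R}
    {p x w : S → A → ℝ} (h : G.IsEquilibrium p x w) (hpart : G.Participation) :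
    ∃ g : ℝ, 0 < g ∧ G.IsTimeAverageReward p w g ∧ G.rewardRate x = G.d * g ∧
      ∀ y, (∀ i a, 0 ≤ y i a) → G.Balanced y → G.rewardRate y ≤ g * pair (G.t + w) y := by
  obtain ⟨hx0, hxp, hxb, hxd⟩ := h.rates_spec
  obtain ⟨V, γ, hV⟩ := h.solvesDP
  have hub : ∀ y, (∀ i a, 0 ≤ y i a) → G.Balanced y →
      G.rewardRate y ≤ -γ * pair (G.t + w) y := fun y hy hyb =>
    rewardRate_le (fun i a => (hV i).1.2 ⟨a, rfl⟩) hy hyb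
  refine ⟨-γ, ?_, tendsto_average h.policy h.delay_nonneg fun i => (hV i).2, ?_, hub⟩
  · obtain ⟨M, hM, ⟨y, ⟨hy, hyb, hyd⟩, rfl⟩, -⟩ := hpart w h.delay_nonneg
    have h1 := hM.trans_le (hub y hy hyb)
    rw [show pair (G.t + w) y = G.d from hyd] at h1
    exact pos_of_mul_pos_left h1 G.d_pos.le
  · rw [rewardRate_eq (fun i a hia => (hV i).2 a (hxp i a hia)) hx0 hxb, hxd, mul_comm]

theorem average_unique [Fintype R] {G : SMDPGame S A R} {p x w p' x' w' : S → A → ℝ}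
    (h : G.IsEquilibrium p x w) (h' : G.IsEquilibrium p' x' w') {g g' : ℝ} (hg : 0 < g)
    (hg' : 0 < g') (hx : G.rewardRate x = G.d * g) (hx' : G.rewardRate x' = G.d * g')
    (hub : ∀ y, (∀ i a, 0 ≤ y i a) → G.Balanced y → G.rewardRate y ≤ g * pair (G.t + w) y)
    (hub' : ∀ y, (∀ i a, 0 ≤ y i a) → G.Balanced y → G.rewardRate y ≤ g' * pair (G.t + w') y) :
    g = g' := by
  obtain ⟨hx0, -, hxb, hxd⟩ := h.rates_spec
  obtain ⟨hx0', -, hxb', hxd'⟩ := h'.rates_spec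
  have h1 := hub x' hx0' hxb'
  have h2 := hub' x hx0 hxb
  have h3 := h.pair_delay_le h'.resource
  have h4 := h'.pair_delay_le h.resource
  rw [pair_add_left] at h1 h2 hxd hxd'
  rw [hx'] at h1
  rw [hx] at h2
  set r := pair G.t x' - pair G.t x
  have h5 : G.d * g' ≤ g * (G.d + r) :=
    h1.trans (mul_le_mul_of_nonneg_left (by simp only [r]; linarith) hg.le)
  have h6 : G.d * g ≤ g' * (G.d - r) :=
    h2.trans (mul_le_mul_of_nonneg_left (by simp only [r]; linarith) hg'.le)
  -- Eliminating `r` leaves `d (g - g') ^ 2 ≤ 0`.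
  have h7 : G.d * (g - g') ^ 2 ≤ 0 := by
    nlinarith [mul_le_mul_of_nonneg_left h5 hg'.le, mul_le_mul_of_nonneg_left h6 hg.le]
  have h8 : (g - g') ^ 2 = 0 :=
    le_antisymm (nonpos_of_mul_nonpos_right h7 G.d_pos) (sq_nonneg _)
  exact sub_eq_zero.1 (pow_eq_zero_iff two_ne_zero |>.1 h8)

/-! ### The Eisenberg-Gale program -/

/-- The polyhedron of nonnegative balanced action rates respecting the resources. -/
def Admissible (G : SMDPGame S A R) (x : S → A → ℝ) : Prop :=
  (∀ i a, 0 ≤ x i a) ∧ G.Balanced x ∧ ∀ q, G.usage x q ≤ G.b q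

/-- The exponential of the Eisenberg-Gale objective `log (c ⬝ x) - (t ⬝ x) / d`. -/
noncomputable def objective (G : SMDPGame S A R) (x : S → A → ℝ) : ℝ :=
  pair G.c x * Real.exp (-(pair G.t x / G.d))

theorem isClosed_admissible (G : SMDPGame S A R) : IsClosed {x | G.Admissible x} := by
  have h : {x | G.Admissible x} = {x | ∀ i a, 0 ≤ x i a} ∩
      ({x | ∀ i, ∑ a, x i a = ∑ j, ∑ a, x j a * G.P a j i} ∩
        {x | ∀ q, pair (G.use q) x ≤ G.b q}) := rfl
  rw [h]
  refine IsClosed.inter ?_ (IsClosed.inter ?_ ?_)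
  · simp only [Set.ofPred_forall]
    exact isClosed_iInter fun i => isClosed_iInter fun a =>
      isClosed_le continuous_const (by fun_prop)
  · simp only [Set.ofPred_forall]
    exact isClosed_iInter fun i => isClosed_eq (by fun_prop) (by fun_prop)
  · simp only [Set.ofPred_forall]
    exact isClosed_iInter fun q => isClosed_le (continuous_pair _) continuous_const

theorem exists_pair_reward_le (G : SMDPGame S A R) :
    ∃ K, 0 < K ∧ ∀ x : S → A → ℝ, (∀ i a, 0 ≤ x i a) → pair G.c x ≤ K * pair G.t x := by
  have hnn : ∀ i a, 0 ≤ |G.c i a / G.t i a| := fun i a => abs_nonneg _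
  refine ⟨1 + ∑ i, ∑ a, |G.c i a / G.t i a|, add_pos_of_pos_of_nonneg one_pos
    (Finset.sum_nonneg fun i _ => Finset.sum_nonneg fun a _ => hnn i a), fun x hx => ?_⟩
  rw [← pair_smul_left]
  refine pair_le_pair hx fun i a _ => ?_
  have h1 : |G.c i a / G.t i a| ≤ ∑ i, ∑ a, |G.c i a / G.t i a| :=
    (Finset.single_le_sum (fun a _ => hnn i a) (Finset.mem_univ a)).trans
      (Finset.single_le_sum (f := fun i => ∑ a, |G.c i a / G.t i a|)
        (fun i _ => Finset.sum_nonneg fun a _ => hnn i a) (Finset.mem_univ i))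
  simp only [Pi.smul_apply, smul_eq_mul]
  rw [← div_le_iff₀ (G.t_pos i a)]
  exact (le_abs_self _).trans (h1.trans (by linarith))

theorem exists_maximizer {G : SMDPGame S A R} (hf : G.Feasibility) :
    ∃ x, G.Admissible x ∧ 0 < pair G.c x ∧ ∀ y, G.Admissible y → G.objective y ≤ G.objective x := by
  obtain ⟨x₀, hx₀, hb₀, hu₀, hr₀⟩ := hf
  have hr₀' : 0 < pair G.c x₀ := hr₀
  have hadm : G.Admissible x₀ := ⟨hx₀, hb₀, hu₀⟩
  have hm : 0 < G.objective x₀ := mul_pos hr₀' (Real.exp_pos _)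
  obtain ⟨K, hK, hcK⟩ := G.exists_pair_reward_le
  have hd := G.d_pos
  -- Since `exp v ≥ v ^ 2 / 2`, the objective is at most `2 K d ^ 2 / (t ⬝ x)`.
  set L := 2 * K * G.d ^ 2 / G.objective x₀
  have hfar : ∀ x, G.Admissible x → L < pair G.t x → G.objective x ≤ G.objective x₀ := by
    intro x hx hL
    have hL0 : 0 < L := by positivity
    set u := pair G.t x
    have hu : 0 < u := hL0.trans hL
    have hexp : (u / G.d) ^ 2 / 2 ≤ Real.exp (u / G.d) := by
      have := Real.quadratic_le_exp_of_nonneg (div_pos hu hd).le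
      have h2 := (div_pos hu hd).le
      linarith
    have h1 : G.objective x ≤ K * u * Real.exp (-(u / G.d)) :=
      mul_le_mul_of_nonneg_right (hcK x hx.1) (Real.exp_pos _).le
    refine h1.trans ?_
    rw [Real.exp_neg, ← div_eq_mul_inv, div_le_iff₀ (Real.exp_pos _)]
    rw [div_lt_iff₀ hm] at hL
    refine le_trans ?_ (mul_le_mul_of_nonneg_left hexp hm.le)
    have h3 : G.objective x₀ * ((u / G.d) ^ 2 / 2) =
        u * G.objective x₀ * (u / (2 * G.d ^ 2)) := by
      field_simp
    rw [h3]
    have h4 : K * u = 2 * K * G.d ^ 2 * (u / (2 * G.d ^ 2)) := by field_simp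
    rw [h4]
    exact mul_le_mul_of_nonneg_right hL.le (by positivity)
  have hcont : Continuous G.objective :=
    (continuous_pair _).mul (Real.continuous_exp.comp ((continuous_pair _).div_const _).neg)
  have hcpt : IsCompact ({x | G.Admissible x} ∩ {x | pair G.t x ≤ max L (pair G.t x₀)}) := by
    refine IsCompact.of_isClosed_subset
      (isCompact_Icc (a := (0 : S → A → ℝ)) (b := fun i a => max L (pair G.t x₀) / G.t i a))
      (G.isClosed_admissible.inter (isClosed_le (continuous_pair _) continuous_const)) ?_
    rintro x ⟨hx, hxL⟩
    refine ⟨fun i a => hx.1 i a, fun i a => ?_⟩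
    rw [le_div_iff₀ (G.t_pos i a), mul_comm]
    have hnn : ∀ i a, 0 ≤ G.t i a * x i a := fun i a => mul_nonneg (G.t_pos i a).le (hx.1 i a)
    exact ((Finset.single_le_sum (fun a _ => hnn i a) (Finset.mem_univ a)).trans
      (Finset.single_le_sum (f := fun i => ∑ a, G.t i a * x i a)
        (fun i _ => Finset.sum_nonneg fun a _ => hnn i a) (Finset.mem_univ i))).trans hxL
  have hx₀L : pair G.t x₀ ≤ max L (pair G.t x₀) := le_max_right _ _
  obtain ⟨x, ⟨hx, -⟩, hmax⟩ := hcpt.exists_isMaxOn ⟨x₀, hadm, hx₀L⟩ hcont.continuousOn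
  have hx₀x : G.objective x₀ ≤ G.objective x := hmax ⟨hadm, hx₀L⟩
  refine ⟨x, hx, pos_of_mul_pos_left (hm.trans_le hx₀x) (Real.exp_pos _).le, fun y hy => ?_⟩
  rcases le_or_gt (pair G.t y) (max L (pair G.t x₀)) with h | h
  · exact hmax ⟨hy, h⟩
  · exact (hfar y hy ((le_max_left _ _).trans_lt h)).trans hx₀x

theorem tendsto_add_mul_nhdsGT (r s : ℝ) :
    Tendsto (fun ε : ℝ => r + ε * s) (𝓝[>] 0) (𝓝 r) := by
  have : Tendsto (fun ε : ℝ => r + ε * s) (𝓝 0) (𝓝 (r + 0 * s)) :=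
    Continuous.tendsto (by fun_prop) 0
  rw [zero_mul, add_zero] at this
  exact this.mono_left nhdsWithin_le_nhds

/-- A direction along which the active constraints at `x` are respected stays in the polyhedron for
a short while. -/
theorem Admissible.eventually_add_smul [Finite R] {G : SMDPGame S A R} {x h : S → A → ℝ}
    (hx : G.Admissible x) (hh0 : ∀ i a, x i a = 0 → 0 ≤ h i a) (hhb : G.Balanced h)
    (hhq : ∀ q, G.usage x q = G.b q → G.usage h q ≤ 0) :
    ∀ᶠ ε in 𝓝[>] (0 : ℝ), G.Admissible (x + ε • h) := by
  have hpos : ∀ᶠ ε in 𝓝[>] (0 : ℝ), 0 < ε := self_mem_nhdsWithin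
  have h1 : ∀ᶠ ε in 𝓝[>] (0 : ℝ), ∀ i a, 0 ≤ x i a + ε * h i a := by
    refine eventually_all.2 fun i => eventually_all.2 fun a => ?_
    rcases (hx.1 i a).eq_or_lt with h0 | h0
    · filter_upwards [hpos] with ε hε
      rw [← h0, zero_add]
      exact mul_nonneg hε.le (hh0 i a h0.symm)
    · exact ((tendsto_add_mul_nhdsGT (x i a) (h i a)).eventually (lt_mem_nhds h0)).mono fun _ => le_of_lt
  have hu : ∀ ε q, G.usage (x + ε • h) q = G.usage x q + ε * G.usage h q := fun ε q => by
    change pair (G.use q) (x + ε • h) = pair (G.use q) x + ε * pair (G.use q) h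
    rw [map_add, map_smul, smul_eq_mul]
  have h2 : ∀ᶠ ε in 𝓝[>] (0 : ℝ), ∀ q, G.usage x q + ε * G.usage h q ≤ G.b q := by
    refine eventually_all.2 fun q => ?_
    rcases (hx.2.2 q).lt_or_eq with h0 | h0
    · exact ((tendsto_add_mul_nhdsGT (G.usage x q) (G.usage h q)).eventually (gt_mem_nhds h0)).mono
        fun _ => le_of_lt
    · filter_upwards [hpos] with ε hε
      rw [← h0]
      linarith [mul_nonpos_of_nonneg_of_nonpos hε.le (hhq q h0)]
  filter_upwards [h1, h2] with ε h1 h2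
  refine ⟨fun i a => h1 i a, fun i => ?_, fun q => (hu ε q).trans_le (h2 q)⟩
  simp only [Pi.add_apply, Pi.smul_apply, smul_eq_mul, add_mul, Finset.sum_add_distrib, mul_assoc,
    ← Finset.mul_sum]
  rw [hx.2.1 i, hhb i]

/-- At a maximiser, the gradient of the Eisenberg-Gale objective is nonpositive on every direction
respecting the active constraints. -/
theorem first_order_condition [Finite R] {G : SMDPGame S A R} {x h : S → A → ℝ}
    (hx : G.Admissible x) (hC : 0 < pair G.c x)
    (hmax : ∀ y, G.Admissible y → G.objective y ≤ G.objective x)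
    (hh0 : ∀ i a, x i a = 0 → 0 ≤ h i a) (hhb : G.Balanced h)
    (hhq : ∀ q, G.usage x q = G.b q → G.usage h q ≤ 0) :
    pair G.c h ≤ pair G.c x / G.d * pair G.t h := by
  set C := pair G.c x
  set H := pair G.c h
  set σ := pair G.t h / G.d
  have key : ∀ᶠ ε in 𝓝[>] (0 : ℝ), H ≤ C * σ + ε * (H * σ) := by
    filter_upwards [hx.eventually_add_smul hh0 hhb hhq, self_mem_nhdsWithin,
      (tendsto_add_mul_nhdsGT C H).eventually (lt_mem_nhds hC)] with ε hadm hε hpos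
    have hε' : 0 < ε := hε
    have h1 := hmax _ hadm
    simp only [objective, map_add, map_smul, smul_eq_mul] at h1
    rw [show -((pair G.t x + ε * pair G.t h) / G.d) = -(pair G.t x / G.d) + -(ε * σ) by
      simp only [σ]; ring, Real.exp_add, mul_left_comm, mul_comm C] at h1
    have h2 : (C + ε * H) * Real.exp (-(ε * σ)) ≤ C := le_of_mul_le_mul_left h1 (Real.exp_pos _)
    have h3 : (C + ε * H) * (1 - ε * σ) ≤ C :=
      (mul_le_mul_of_nonneg_left (Real.one_sub_le_exp_neg _) hpos.le).trans h2
    refine le_of_mul_le_mul_left ?_ hε'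
    linarith
  have := ge_of_tendsto (tendsto_add_mul_nhdsGT (C * σ) (H * σ)) key
  calc H ≤ C * σ := this
    _ = _ := by simp only [σ]; ring

/-- Lagrange multipliers for the Eisenberg-Gale program: potentials for the balance constraints and
prices for the resources. -/
theorem exists_multipliers [Fintype R] {G : SMDPGame S A R} {x : S → A → ℝ}
    (hx : G.Admissible x) (hC : 0 < pair G.c x)
    (hmax : ∀ y, G.Admissible y → G.objective y ≤ G.objective x) :
    ∃ (V : S → ℝ) (η : R → ℝ), (∀ q, 0 ≤ η q) ∧ (∀ q, G.usage x q < G.b q → η q = 0) ∧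
      ∀ i a, G.c i a - pair G.c x / G.d * G.t i a - ∑ q, G.use q i a * η q +
          ∑ j, G.P a i j * V j ≤ V i ∧
        (0 < x i a → G.c i a - pair G.c x / G.d * G.t i a - ∑ q, G.use q i a * η q +
          ∑ j, G.P a i j * V j = V i) := by
  classical
  set κ := pair G.c x / G.d
  -- The functionals are the resource usages, the negated coordinates, and the inflow minus outflow
  -- at each state with both signs; the first two kinds enter only where active.
  let g : R ⊕ (S × A) ⊕ S ⊕ S → (S → A → ℝ) →ₗ[ℝ] ℝ :=
    Sum.elim (fun q => pair (G.use q)) (Sum.elim (fun ia => pair (-Pi.single ia.1 (Pi.single ia.2 1)))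
      (Sum.elim (fun i => pair (G.drift (Pi.single i 1))) fun i => pair (-G.drift (Pi.single i 1))))
  let s : Finset (R ⊕ (S × A) ⊕ S ⊕ S) := Finset.univ.filter
    (Sum.elim (fun q => G.usage x q = G.b q) (Sum.elim (fun ia => x ia.1 ia.2 = 0) fun _ => True))
  have hsingle : ∀ (i : S) (a : A) (y : S → A → ℝ),
      pair (Pi.single i (Pi.single a 1)) y = y i a := fun i a y => by
    rw [pair_apply, Finset.sum_eq_single i, Finset.sum_eq_single a] <;>
      simp +contextual [Pi.single_apply]
  have hneg : ∀ u y : S → A → ℝ, pair (-u) y = -pair u y := fun u y => by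
    simp [pair_apply]
  obtain ⟨l, hl0, hls, hlf⟩ := exists_nonneg_sum_smul_eq s g (pair (G.c + (-κ) • G.t)) (by
    intro h hh
    have hq : ∀ q, G.usage x q = G.b q → G.usage h q ≤ 0 := fun q hq =>
      hh (Sum.inl q) (by simpa [s] using hq)
    have h0 : ∀ i a, x i a = 0 → 0 ≤ h i a := fun i a hia => by
      have := hh (Sum.inr (Sum.inl (i, a))) (by simpa [s] using hia)
      simp only [g, Sum.elim_inr, Sum.elim_inl, hneg, hsingle] at this
      linarith
    have hb : G.Balanced h := fun i => by
      have h1 := hh (Sum.inr (Sum.inr (Sum.inl i))) (by simp [s])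
      have h2 := hh (Sum.inr (Sum.inr (Sum.inr i))) (by simp [s])
      simp only [g, Sum.elim_inr, Sum.elim_inl, hneg] at h1 h2
      have h3 : pair (G.drift (Pi.single i 1)) h = 0 := by linarith
      rw [pair_drift, Finset.sum_eq_single i (fun j _ hj => by
        rw [Pi.single_eq_of_ne hj, zero_mul]) (by simp), Pi.single_eq_same, one_mul] at h3
      linarith
    have := first_order_condition hx hC hmax h0 hb hq
    rw [pair_add_left, pair_smul_left]
    linarith)
  rw [Finset.sum_subset (Finset.subset_univ s) fun k _ hk => by rw [hls k hk, zero_smul]] at hlf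
  have hdrift : ∀ i j a, G.drift (Pi.single j 1) i a = G.P a i j - (Pi.single j 1 : S → ℝ) i := by
    intro i j a
    simp [drift, Pi.single_apply]
  let V : S → ℝ := fun j => l (Sum.inr (Sum.inr (Sum.inr j))) - l (Sum.inr (Sum.inr (Sum.inl j)))
  have hval : ∀ i a, G.c i a - κ * G.t i a - ∑ q, G.use q i a * l (Sum.inl q) +
      ∑ j, G.P a i j * V j = V i - l (Sum.inr (Sum.inl (i, a))) := by
    intro i a
    have hev : ∀ u : S → A → ℝ, pair u (Pi.single i (Pi.single a 1)) = u i a := fun u => by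
      rw [← hsingle i a u]
      simp only [pair_apply, mul_comm]
    have h1 := LinearMap.congr_fun hlf (Pi.single i (Pi.single a 1))
    rw [LinearMap.sum_apply] at h1
    simp only [LinearMap.smul_apply, smul_eq_mul, Fintype.sum_sum_type, g,
      Sum.elim_inl, Sum.elim_inr, hev, Pi.add_apply, Pi.smul_apply, Pi.neg_apply, hdrift] at h1
    have h2 : ∑ ia : S × A, l (Sum.inr (Sum.inl ia)) *
        -(Pi.single ia.1 (Pi.single ia.2 1) : S → A → ℝ) i a = -l (Sum.inr (Sum.inl (i, a))) := by
      rw [Finset.sum_eq_single (i, a)]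
      · simp
      · rintro ⟨j, b⟩ - hne
        rcases eq_or_ne i j with rfl | hij
        · have hab : a ≠ b := fun h => hne (by rw [h])
          simp [hab]
        · simp [hij]
      · simp
    have h3 : ∀ m : S → ℝ, ∑ j, m j * (G.P a i j - (Pi.single j 1 : S → ℝ) i) =
        ∑ j, G.P a i j * m j - m i := fun m => by
      simp only [mul_sub, Finset.sum_sub_distrib]
      congr 1
      · exact Finset.sum_congr rfl fun j _ => mul_comm _ _
      · rw [Finset.sum_eq_single i] <;> simp +contextual [eq_comm]
    rw [h2, h3] at h1
    simp only [mul_neg, Finset.sum_neg_distrib] at h1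
    rw [h3] at h1
    simp only [V, mul_sub, Finset.sum_sub_distrib]
    simp only [mul_comm (l (Sum.inl _))] at h1
    linarith
  refine ⟨V, fun q => l (Sum.inl q), fun q => hl0 _, fun q hq => hls _ ?_, fun i a => ⟨?_, ?_⟩⟩
  · simpa [s] using hq.ne
  · rw [hval]
    linarith [hl0 (Sum.inr (Sum.inl (i, a)))]
  · intro hia
    rw [hval, hls (Sum.inr (Sum.inl (i, a))) (by simpa [s] using hia.ne'), sub_zero]

/-! ### Existence of an equilibrium -/

/-- Nonzero balanced rates come from a policy and a positive invariant vector of its chain. -/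
theorem Balanced.exists_policy {G : SMDPGame S A R} {x : S → A → ℝ}
    (hb : G.Balanced x) (hx : ∀ i a, 0 ≤ x i a) (hne : x ≠ 0) :
    ∃ (p : S → A → ℝ) (y : S → ℝ), IsPolicy p ∧ (∀ i, 0 < y i) ∧ y ᵥ* G.chain p = y ∧
      (fun i a => y i * p i a) = x := by
  classical
  obtain ⟨i₀, hi₀⟩ := Function.ne_iff.1 hne
  obtain ⟨a₀, ha₀⟩ := Function.ne_iff.1 hi₀
  let y : S → ℝ := fun i => ∑ a, x i a
  -- The choice in a state that is not visited is immaterial; by irreducibility there is none.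
  let p : S → A → ℝ := fun i => if y i = 0 then Pi.single a₀ 1 else fun a => x i a / y i
  have hy0 : ∀ i, 0 ≤ y i := fun i => Finset.sum_nonneg fun a _ => hx i a
  have hp : IsPolicy p := fun i => by
    by_cases h : y i = 0
    · simp only [p, if_pos h]
      exact single_mem_stdSimplex ℝ a₀
    · simp only [p, if_neg h]
      exact ⟨fun a => div_nonneg (hx i a) (hy0 i), by rw [← Finset.sum_div]; exact div_self h⟩
  have hyp : ∀ i a, y i * p i a = x i a := fun i a => by
    by_cases h : y i = 0
    · rw [h, zero_mul]
      exact ((Finset.sum_eq_zero_iff_of_nonneg fun a _ => hx i a).1 h a (Finset.mem_univ a)).symm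
    · simp only [p, if_neg h]
      exact mul_div_cancel₀ _ h
  have hinv : y ᵥ* G.chain p = y := funext fun i => by
    rw [vecMul_chain_apply]
    simp only [hyp]
    exact (hb i).symm
  have hi₀pos : 0 < y i₀ := Finset.sum_pos' (fun a _ => hx i₀ a)
    ⟨a₀, Finset.mem_univ a₀, (hx i₀ a₀).lt_of_ne' ha₀⟩
  exact ⟨p, y, hp, G.pos_of_vecMul_chain_eq hp hinv hy0 hi₀pos, hinv,
    funext fun i => funext fun a => hyp i a⟩

theorem exists_isEquilibrium [Fintype R] {G : SMDPGame S A R} (hf : G.Feasibility) :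
    ∃ p x w : S → A → ℝ, G.IsEquilibrium p x w := by
  obtain ⟨x, hx, hC, hmax⟩ := exists_maximizer hf
  obtain ⟨V, η, hη, hslack, hV⟩ := exists_multipliers hx hC hmax
  obtain ⟨p, y, hp, hy, hinv, hyp⟩ := hx.2.1.exists_policy hx.1 (by
    rintro rfl
    rw [map_zero] at hC
    exact lt_irrefl _ hC)
  have hd := G.d_pos
  set C := pair G.c x with hCdef
  let δ : R → ℝ := fun q => G.d / C * η q
  let w : S → A → ℝ := fun i a => ∑ q, G.use q i a * δ q
  have hγ : ∀ i a, G.c i a + -(C / G.d) * (G.t i a + w i a) + ∑ j, G.P a i j * V j =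
      G.c i a - C / G.d * G.t i a - ∑ q, G.use q i a * η q + ∑ j, G.P a i j * V j := by
    intro i a
    have : C / G.d * w i a = ∑ q, G.use q i a * η q := by
      simp only [w, δ, Finset.mul_sum]
      exact Finset.sum_congr rfl fun q _ => by field_simp
    rw [← this]
    ring
  have hxpos : ∀ i a, 0 < p i a → 0 < x i a := fun i a h => by
    rw [← hyp]
    exact mul_pos (hy i) h
  have hDP : ∀ i a, 0 < x i a →
      G.c i a + -(C / G.d) * (G.t i a + w i a) + ∑ j, G.P a i j * V j = V i :=
    fun i a h => (hγ i a).trans ((hV i a).2 h)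
  -- At the maximiser the players' time is exactly used up.
  have htime : pair (G.t + w) x = G.d := by
    have h1 : C = C / G.d * pair (G.t + w) x := by
      have := rewardRate_eq hDP hx.1 hx.2.1
      rwa [neg_neg] at this
    field_simp at h1
    exact h1.symm
  have hY : 0 < ∑ i, y i := by
    obtain ⟨i, -, -⟩ := Finset.exists_ne_zero_of_sum_ne_zero hC.ne'
    exact Finset.sum_pos (fun i _ => hy i) ⟨i, Finset.mem_univ i⟩
  have hD : ∑ j, y j * G.meanTime p w j = G.d := by
    rw [← pair_mul_policy, hyp, htime]
  refine ⟨p, x, w, hp, ⟨V, -(C / G.d), fun i => ⟨⟨?_, ?_⟩, fun a h => hDP i a (hxpos i a h)⟩⟩,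
    ⟨fun i => y i / G.d, ⟨(∑ i, y i)⁻¹ • y, ⟨⟨fun i => ?_, ?_⟩, ?_⟩, fun i => ?_⟩, fun i a => ?_⟩,
    hx.2.2, ⟨δ, fun q => mul_nonneg (div_pos hd hC).le (hη q), fun i a => rfl, fun q hq => ?_⟩⟩
  · obtain ⟨a, -, ha⟩ := Finset.exists_ne_zero_of_sum_ne_zero
      (show ∑ a, p i a ≠ 0 by rw [(hp i).2]; exact one_ne_zero)
    exact ⟨a, hDP i a (hxpos i a (((hp i).1 a).lt_of_ne' ha))⟩
  · rintro _ ⟨a, rfl⟩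
    exact (hγ i a).trans_le (hV i a).1
  · exact mul_nonneg (inv_pos.2 hY).le (hy i).le
  · simp only [Pi.smul_apply, smul_eq_mul, ← Finset.mul_sum]
    exact inv_mul_cancel₀ hY.ne'
  · rw [Matrix.smul_vecMul, hinv]
  · simp only [Pi.smul_apply, smul_eq_mul, mul_assoc, ← Finset.mul_sum, hD]
    field_simp
  · rw [mul_div_cancel₀ _ hd.ne']
    exact (congrFun (congrFun hyp i) a).symm
  · simp only [δ, hslack q hq, mul_zero]

end SMDPGame

theorem mainTheorem6 {S A R : Type*} [Fintype S] [DecidableEq S] [Fintype A] [Fintype R]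
    (G : SMDPGame S A R) :
    (G.Feasibility → ∃ p x w : S → A → ℝ, G.IsEquilibrium p x w) ∧
    (G.Participation → ∃ ρ : ℝ, ∀ p x w : S → A → ℝ, G.IsEquilibrium p x w →
      G.IsTimeAverageReward p w ρ ∧ G.rewardRate x = G.d * ρ) := by
  refine ⟨SMDPGame.exists_isEquilibrium, fun hpart => ?_⟩
  by_cases hex : ∃ p x w : S → A → ℝ, G.IsEquilibrium p x w
  · obtain ⟨p, x, w, h⟩ := hex
    obtain ⟨g, hg, -, hr, hub⟩ := h.exists_average hpart
    refine ⟨g, fun p' x' w' h' => ?_⟩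
    obtain ⟨g', hg', ha', hr', hub'⟩ := h'.exists_average hpart
    obtain rfl := SMDPGame.average_unique h h' hg hg' hr hr' hub hub'
    exact ⟨ha', hr'⟩
  · exact ⟨0, fun p x w h => absurd ⟨p, x, w, h⟩ hex⟩
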